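/- Let $(X,\mu)$ be a probability space and let $k:X\times X\to\mathbb{R}$ be a measurable, symmetric, positive semidefinite kernel with $k(x,x)=1$ for all $x\in X$. Then the integral operator $(K\varphi)(x)=\int_X k(x,y)\varphi(y)\,\mu(dy)$ on $L^2(\mu)$ has a largest eigenvalue $\gamma_{\max}$, and the following holds. Let $n\in\mathbb{N}$, let $x_1,\dots,x_n$ be i.i.d. random points with distribution $\mu$, let $f\in L^2(\mu)$ be real-valued, and put $y_i=f(x_i)$. For $\lambda\ge 0$ let $\hat f_n^\lambda=\sum_{i=1}^n\alpha_i\,k(x_i,\cdot)$ with $\alpha=(K_n+\lambda\,\mathrm{id})^{-1}y$ and $(K_n)_{ij}=k(x_i,x_j)$ be the kernel ridge regression estimator for the data $(x_i,y_i)_{i=1}^n$. Then for every $\varepsilon>0$, with probability at least $1-\varepsilon-\gamma_{\max}n^4$, simultaneously for all $\lambda\ge 0$, the matrix $K_n+\lambda\,\mathrm{id}$ is invertible (so that $\hat f_n^\lambda$ is well defined) and $$\|f-\hat f_n^\lambda\|_2\ \ge\ \left(1-\sqrt{\frac{2\gamma_{\max}n^2}{\varepsilon}}\right)\|f\|_2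 ,$$ where $\|\cdot\|_2$ is the norm of $L^2(\mu)$. -/

import Mathlib

open MeasureTheory ProbabilityTheory

/-- A real-valued reproducing kernel: a symmetric function `k` all of whose finite quadratic forms
`∑ i j, c i * k (x i) (x j) * c j` are nonnegative. (`Matrix.PosSemidef` over an arbitrary index
type tests finitely supported vectors.) -/
def IsKernel {X : Type*} (k : X → X → ℝ) : Prop :=
  (Matrix.of k).PosSemidef

/-- The integral operator `(K φ)(x) = ∫ k(x, y) φ(y) μ(dy)`. -/
noncomputable def integralOperator {X : Type*} [MeasurableSpace X] (k : X → X → ℝ)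
    (μ : Measure X) (φ : X → ℝ) : X → ℝ :=
  fun x => ∫ y, k x y * φ y ∂μ

/-- `γ` is an eigenvalue of the integral operator on `L²(μ)`: there is a square integrable `φ`,
nonzero in `L²(μ)`, such that `K φ = γ φ` holds `μ`-almost everywhere. -/
def IsIntegralOperatorEigenvalue {X : Type*} [MeasurableSpace X] (k : X → X → ℝ)
    (μ : Measure X) (γ : ℝ) : Prop :=
  ∃ φ : X → ℝ, MemLp φ 2 μ ∧ (¬ φ =ᵐ[μ] 0) ∧
    integralOperator k μ φ =ᵐ[μ] fun x => γ * φ x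

/-- The kernel matrix `K(x, x)_{ij} = k(x_i, x_j)` of the points `x_1, …, x_n`. -/
def kernelMatrix {X : Type*} (k : X → X → ℝ) {n : ℕ} (x : Fin n → X) :
    Matrix (Fin n) (Fin n) ℝ :=
  Matrix.of fun i j => k (x i) (x j)

/-- The regularized kernel matrix `K(x, x) + lam • id`. -/
def regularizedKernelMatrix {X : Type*} (k : X → X → ℝ) (lam : ℝ) {n : ℕ} (x : Fin n → X) :
    Matrix (Fin n) (Fin n) ℝ :=
  kernelMatrix k x + lam • (1 : Matrix (Fin n) (Fin n) ℝ)

/-- The coefficients `α = (K(x, x) + lam • id)⁻¹ y` of kernel ridge regression. They are meaningful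
when the regularized kernel matrix is invertible, which is automatic for `lam > 0`. -/
noncomputable def ridgeCoeff {X : Type*} (k : X → X → ℝ) (lam : ℝ) {n : ℕ} (x : Fin n → X)
    (y : Fin n → ℝ) : Fin n → ℝ :=
  Matrix.mulVec (regularizedKernelMatrix k lam x)⁻¹ y

/-- The kernel ridge regression estimator `z ↦ ∑ i, α_i k(x_i, z)` for the training data
`(x_i, y_i)` and the regularization parameter `lam`. -/
noncomputable def ridgeEstimator {X : Type*} (k : X → X → ℝ) (lam : ℝ) {n : ℕ} (x : Fin n → X)
    (y : Fin n → ℝ) : X → ℝ :=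
  fun z => ∑ i, ridgeCoeff k lam x y i * k (x i) z

/-! A small `γmax` makes the kernel sections nearly orthogonal to everything: `‖∑ αᵢ k(xᵢ, ·)‖² ≤
γmax αᵀKα` (`integral_sq_kernel_combination_le`). For one point this reads `∫ k(x, ·)² ≤ γmax`, so
off-diagonal kernel entries are small in mean square. By Markov, outside probability `γmax n⁴` their
squares sum to at most `1/4`, hence `K ≥ 1/2` as a form, every `K + λ` is invertible and `αᵀKα ≤
2|y|²` for all `λ ≥ 0` at once. A second Markov bound gives `|y|² ≤ (n²/ε)‖f‖²` outside probability
`ε`. Thus the estimator has norm at most `√(2 γmax n²/ε) ‖f‖`, and the triangle inequality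
concludes.

Two facts support this without a reproducing kernel Hilbert space. Finite positivity of `k` extends
to `∑ αᵢ δ_{xᵢ} + φ μ` by replacing `φ μ` with random samples (`mixed_form_nonneg`). The operator is
compact, symmetric and positive on `L²(μ)`, so its norm is its largest eigenvalue and dominates the
quadratic form. -/

section Kernel

variable {X : Type*} {k : X → X → ℝ}

theorem IsKernel.quadForm_nonneg (hk : IsKernel k) {ι : Type*} [Fintype ι] (z : ι → X)
    (c : ι → ℝ) : 0 ≤ ∑ i, ∑ j, c i * k (z i) (z j) * c j := by
  have h := (Matrix.PosSemidef.submatrix hk z).dotProduct_mulVec_nonneg c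
  simpa [dotProduct, Matrix.mulVec, Finset.mul_sum, mul_assoc] using h

theorem IsKernel.symm (hk : IsKernel k) (x y : X) : k x y = k y x := by
  simpa using hk.1.apply y x

theorem IsKernel.abs_le_one (hk : IsKernel k) (hk_diag : ∀ x, k x x = 1) (x y : X) :
    |k x y| ≤ 1 := by
  have h1 := hk.quadForm_nonneg ![x, y] ![1, 1]
  have h2 := hk.quadForm_nonneg ![x, y] ![1, -1]
  simp [Fin.sum_univ_two, hk_diag, hk.symm y x] at h1 h2
  rw [abs_le]
  constructor <;> linarith

end Kernel

/-! ### Joint law of two independent sample points. -/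

section PairLaw

variable {X Ω : Type*} [MeasurableSpace X] [MeasurableSpace Ω] {μ : Measure X} {P : Measure Ω}

theorem integral_comp_measurePreserving {g : Ω → X} (hg : MeasurePreserving g P μ) {f : X → ℝ}
    (hf : AEStronglyMeasurable f μ) : ∫ ω, f (g ω) ∂P = ∫ x, f x ∂μ := by
  have hf' : AEStronglyMeasurable f (P.map g) := hg.map_eq.symm ▸ hf
  rw [← integral_map hg.measurable.aemeasurable hf', hg.map_eq]

theorem measurePreserving_pair [IsProbabilityMeasure P] {ι : Type*} {x : ι → Ω → X} (hx : ∀ i, Measurable (x i))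
    (hlaw : ∀ i, P.map (x i) = μ) (hind : iIndepFun x P) {i j : ι} (hij : i ≠ j) :
    MeasurePreserving (fun ω => (x i ω, x j ω)) P (μ.prod μ) := by
  refine ⟨(hx i).prodMk (hx j), ?_⟩
  have h := (indepFun_iff_map_prod_eq_prod_map_map (hx i).aemeasurable
    (hx j).aemeasurable).1 (hind.indepFun hij)
  rw [h, hlaw, hlaw]

end PairLaw

/-! ### Positivity and Cauchy-Schwarz for the integral form. -/

section IntegralForm

variable {X : Type*} [MeasurableSpace X] {μ : Measure X} [IsProbabilityMeasure μ]
  {k : X → X → ℝ}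

theorem memLp_kernel_section (hk : IsKernel k) (hk_meas : Measurable (Function.uncurry k))
    (hk_diag : ∀ x, k x x = 1) (x : X) : MemLp (k x) 2 μ :=
  MemLp.of_bound (hk_meas.of_uncurry_left).aestronglyMeasurable 1
    (Filter.Eventually.of_forall fun y => hk.abs_le_one hk_diag x y)

theorem integrable_kernel_mul (hk : IsKernel k) (hk_meas : Measurable (Function.uncurry k))
    (hk_diag : ∀ x, k x x = 1) (x : X) {φ : X → ℝ} (hφ : MemLp φ 2 μ) :
    Integrable (fun y => k x y * φ y) μ :=
  (memLp_kernel_section hk hk_meas hk_diag x).integrable_mul hφ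

theorem integrable_kernel_form (hk : IsKernel k) (hk_meas : Measurable (Function.uncurry k))
    (hk_diag : ∀ x, k x x = 1) {φ ψ : X → ℝ} (hφ : MemLp φ 2 μ) (hψ : MemLp ψ 2 μ) :
    Integrable (fun p : X × X => ψ p.1 * (k p.1 p.2 * φ p.2)) (μ.prod μ) := by
  have h := ((hψ.integrable one_le_two).mul_prod (hφ.integrable one_le_two)).bdd_mul (c := 1)
    hk_meas.aestronglyMeasurable
    (Filter.Eventually.of_forall fun p => hk.abs_le_one hk_diag p.1 p.2)
  refine h.congr (Filter.Eventually.of_forall fun p => ?_)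
  simp only [Function.uncurry]
  ring

/-- The quadratic form `∬ φ(x) k(x, y) φ(y) μ(dy) μ(dx)` of the integral operator. -/
noncomputable def kernelEnergy (k : X → X → ℝ) (μ : Measure X) (φ : X → ℝ) : ℝ :=
  ∫ x, φ x * integralOperator k μ φ x ∂μ

theorem integral_prod_kernel_form (hk : IsKernel k)
    (hk_meas : Measurable (Function.uncurry k)) (hk_diag : ∀ x, k x x = 1) {φ ψ : X → ℝ}
    (hφ : MemLp φ 2 μ) (hψ : MemLp ψ 2 μ) :
    ∫ p : X × X, ψ p.1 * (k p.1 p.2 * φ p.2) ∂(μ.prod μ) =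
      ∫ x, ψ x * integralOperator k μ φ x ∂μ := by
  rw [integral_prod _ (integrable_kernel_form hk hk_meas hk_diag hφ hψ)]
  simp only [integralOperator, integral_const_mul]

theorem integral_mul_integralOperator_comm (hk : IsKernel k)
    (hk_meas : Measurable (Function.uncurry k)) (hk_diag : ∀ x, k x x = 1) {φ ψ : X → ℝ}
    (hφ : MemLp φ 2 μ) (hψ : MemLp ψ 2 μ) :
    ∫ x, ψ x * integralOperator k μ φ x ∂μ = ∫ x, φ x * integralOperator k μ ψ x ∂μ := by
  rw [← integral_prod_kernel_form hk hk_meas hk_diag hφ hψ,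
    ← integral_prod_kernel_form hk hk_meas hk_diag hψ hφ,
    ← integral_prod_swap]
  refine integral_congr_ae (Filter.Eventually.of_forall fun p => ?_)
  simp only [Prod.fst_swap, Prod.snd_swap]
  rw [hk.symm]
  ring

/-- Positivity of the kernel on the sum of a discrete signed measure and `φ μ`, with the error
term coming from approximating `φ μ` by `m` independent samples. -/
theorem mixed_form_add_div_nonneg (hk : IsKernel k)
    (hk_meas : Measurable (Function.uncurry k)) (hk_diag : ∀ x, k x x = 1) {n : ℕ}
    (x : Fin n → X) (α : Fin n → ℝ) {φ : X → ℝ} (hφ : MemLp φ 2 μ) {m : ℕ} (hm : 0 < m) :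
    0 ≤ (∑ i, ∑ j, α i * k (x i) (x j) * α j) + 2 * ∑ i, α i * integralOperator k μ φ (x i) +
      kernelEnergy k μ φ + ((∫ y, φ y ^ 2 ∂μ) - kernelEnergy k μ φ) / m := by
  set P : Measure (Fin m → X) := Measure.pi fun _ => μ
  set A := ∑ i, ∑ j, α i * k (x i) (x j) * α j with hA
  set Q := kernelEnergy k μ φ with hQ
  have hm' : (m : ℝ) ≠ 0 := by positivity
  have hev : ∀ j : Fin m, MeasurePreserving (fun z : Fin m → X => z j) P μ :=
    fun j => measurePreserving_eval (fun _ => μ) j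
  have hind : iIndepFun (fun (j : Fin m) (z : Fin m → X) => z j) P :=
    iIndepFun_pi (X := fun _ => id) fun _ => aemeasurable_id
  have hpair : ∀ {j l : Fin m}, j ≠ l →
      MeasurePreserving (fun z : Fin m → X => (z j, z l)) P (μ.prod μ) := fun h =>
    measurePreserving_pair (fun j => (hev j).measurable) (fun j => (hev j).map_eq) hind h
  set B : (Fin m → X) → ℝ := fun z => ∑ j, ∑ i, α i * (k (x i) (z j) * φ (z j)) with hB
  set C : (Fin m → X) → ℝ := fun z => ∑ j, ∑ l, φ (z j) * (k (z j) (z l) * φ (z l)) with hC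
  have hpos : ∀ z, 0 ≤ A + (2 / m * B z + 1 / m ^ 2 * C z) := by
    intro z
    -- Finite positivity at the fixed points with weights `α` together with the samples with weights
    -- `φ(zⱼ)/m`; integrating over `z` then gives the claim.
    have h := hk.quadForm_nonneg (Sum.elim x z) (Sum.elim α fun j => φ (z j) / m)
    simp only [Fintype.sum_sum_type, Sum.elim_inl, Sum.elim_inr, Finset.sum_add_distrib] at h
    have e1 : ∑ i, ∑ j, α i * k (x i) (z j) * (φ (z j) / m) = 1 / m * B z := by
      rw [hB, Finset.sum_comm]
      simp only [Finset.mul_sum]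
      refine Finset.sum_congr rfl fun j _ => Finset.sum_congr rfl fun i _ => ?_
      ring
    have e2 : ∑ j, ∑ i, φ (z j) / m * k (z j) (x i) * α i = 1 / m * B z := by
      simp only [hB, Finset.mul_sum]
      refine Finset.sum_congr rfl fun j _ => Finset.sum_congr rfl fun i _ => ?_
      rw [hk.symm (z j)]
      ring
    have e3 : ∑ j, ∑ l, φ (z j) / m * k (z j) (z l) * (φ (z l) / m) = 1 / m ^ 2 * C z := by
      simp only [hC, Finset.mul_sum]
      refine Finset.sum_congr rfl fun j _ => Finset.sum_congr rfl fun i _ => ?_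
      ring
    rw [e1, e2, e3] at h
    calc (0 : ℝ) ≤ _ := h
      _ = _ := by rw [hA]; ring
  have iB : ∀ (j : Fin m) (i : Fin n),
      Integrable (fun z : Fin m → X => α i * (k (x i) (z j) * φ (z j))) P := fun j i =>
    ((hev j).integrable_comp_of_integrable
      (integrable_kernel_mul hk hk_meas hk_diag (x i) hφ)).const_mul (α i)
  have hBint : Integrable B P :=
    integrable_finsetSum _ fun j _ => integrable_finsetSum _ fun i _ => iB j i
  have hBval : ∫ z, B z ∂P = m * ∑ i, α i * integralOperator k μ φ (x i) := by
    rw [hB, integral_finsetSum _ fun j _ => integrable_finsetSum _ fun i _ => iB j i]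
    rw [Finset.sum_congr rfl (g := fun _ => ∑ i, α i * integralOperator k μ φ (x i))]
    · simp
    intro j _
    rw [integral_finsetSum _ fun i _ => iB j i]
    refine Finset.sum_congr rfl fun i _ => ?_
    rw [integral_const_mul]
    congr 1
    exact integral_comp_measurePreserving (hev j)
      (integrable_kernel_mul hk hk_meas hk_diag (x i) hφ).aestronglyMeasurable
  -- Independent pairs integrate to `Q`. The `m` diagonal pairs give `∫ φ²` instead, since `k(z, z)
  -- = 1`; after division by `m²` this is the `1/m` error.
  have iC : ∀ j l : Fin m,
      Integrable (fun z : Fin m → X => φ (z j) * (k (z j) (z l) * φ (z l))) P ∧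
      ∫ z, φ (z j) * (k (z j) (z l) * φ (z l)) ∂P =
        Q + if j = l then (∫ y, φ y ^ 2 ∂μ) - Q else 0 := by
    intro j l
    by_cases hjl : j = l
    · subst hjl
      have e : (fun z : Fin m → X => φ (z j) * (k (z j) (z j) * φ (z j))) =
          (fun y => φ y ^ 2) ∘ fun z : Fin m → X => z j := by
        funext z
        simp only [hk_diag, Function.comp]
        ring
      have hint : Integrable (fun y => φ y ^ 2) μ := hφ.integrable_sq
      refine ⟨by rw [e]; exact (hev j).integrable_comp_of_integrable hint, ?_⟩
      rw [e]
      simpa [Function.comp_def] using integral_comp_measurePreserving (hev j) hint.aestronglyMeasurable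
    · have hint := integrable_kernel_form hk hk_meas hk_diag hφ hφ
      refine ⟨(hpair hjl).integrable_comp_of_integrable hint, ?_⟩
      have h := integral_comp_measurePreserving (hpair hjl) hint.aestronglyMeasurable
      rw [integral_prod_kernel_form hk hk_meas hk_diag hφ hφ] at h
      rw [h]
      simp [hjl, hQ, kernelEnergy]
  have hCint : Integrable C P :=
    integrable_finsetSum _ fun j _ => integrable_finsetSum _ fun l _ => (iC j l).1
  have hCval : ∫ z, C z ∂P = m ^ 2 * Q + m * ((∫ y, φ y ^ 2 ∂μ) - Q) := by
    rw [hC, integral_finsetSum _ fun j _ => integrable_finsetSum _ fun l _ => (iC j l).1]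
    rw [Finset.sum_congr rfl (g := fun _ => m * Q + ((∫ y, φ y ^ 2 ∂μ) - Q))]
    · simp
      ring
    intro j _
    rw [integral_finsetSum _ fun l _ => (iC j l).1]
    simp [(iC j _).2, Finset.sum_add_distrib]
  have h0 : 0 ≤ ∫ z, (A + (2 / m * B z + 1 / m ^ 2 * C z)) ∂P := integral_nonneg hpos
  have hBC : Integrable (fun z => 2 / m * B z + 1 / m ^ 2 * C z) P :=
    (hBint.const_mul _).add (hCint.const_mul _)
  rw [integral_add (integrable_const _) hBC,
    integral_add (hBint.const_mul _) (hCint.const_mul _), integral_const_mul,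
    integral_const_mul, hBval, hCval] at h0
  simp only [integral_const, probReal_univ, smul_eq_mul, one_mul] at h0
  refine h0.trans_eq ?_
  field_simp
  ring

theorem mixed_form_nonneg (hk : IsKernel k)
    (hk_meas : Measurable (Function.uncurry k)) (hk_diag : ∀ x, k x x = 1) {n : ℕ}
    (x : Fin n → X) (α : Fin n → ℝ) {φ : X → ℝ} (hφ : MemLp φ 2 μ) :
    0 ≤ (∑ i, ∑ j, α i * k (x i) (x j) * α j) + 2 * ∑ i, α i * integralOperator k μ φ (x i) +
      kernelEnergy k μ φ := by
  have hlim := (tendsto_const_div_atTop_nhds_zero_nat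
    ((∫ y, φ y ^ 2 ∂μ) - kernelEnergy k μ φ)).const_add
    ((∑ i, ∑ j, α i * k (x i) (x j) * α j) + 2 * ∑ i, α i * integralOperator k μ φ (x i) +
      kernelEnergy k μ φ)
  rw [add_zero] at hlim
  refine ge_of_tendsto hlim ?_
  filter_upwards [Filter.eventually_gt_atTop 0] with m hm
  exact mixed_form_add_div_nonneg hk hk_meas hk_diag x α hφ hm

theorem kernelEnergy_nonneg (hk : IsKernel k)
    (hk_meas : Measurable (Function.uncurry k)) (hk_diag : ∀ x, k x x = 1)
    {φ : X → ℝ} (hφ : MemLp φ 2 μ) : 0 ≤ kernelEnergy k μ φ := by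
  simpa using mixed_form_nonneg hk hk_meas hk_diag (Fin.elim0 : Fin 0 → X) 0 hφ

/-- Cauchy-Schwarz for the kernel form between a discrete signed measure and `φ μ`. -/
theorem sq_sum_integralOperator_le (hk : IsKernel k)
    (hk_meas : Measurable (Function.uncurry k)) (hk_diag : ∀ x, k x x = 1) {n : ℕ}
    (x : Fin n → X) (α : Fin n → ℝ) {φ : X → ℝ} (hφ : MemLp φ 2 μ) :
    (∑ i, α i * integralOperator k μ φ (x i)) ^ 2 ≤
      (∑ i, ∑ j, α i * k (x i) (x j) * α j) * kernelEnergy k μ φ := by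
  -- Scaling `α` by `s` gives a nonnegative quadratic in `s`, so its discriminant is nonpositive.
  have h : ∀ s : ℝ, 0 ≤ (∑ i, ∑ j, α i * k (x i) (x j) * α j) * (s * s) +
      (2 * ∑ i, α i * integralOperator k μ φ (x i)) * s + kernelEnergy k μ φ := by
    intro s
    refine (mixed_form_nonneg hk hk_meas hk_diag x (fun i => s * α i) hφ).trans_eq ?_
    simp only [Finset.mul_sum, Finset.sum_mul]
    congr 2
    · refine Finset.sum_congr rfl fun i _ => Finset.sum_congr rfl fun j _ => ?_
      ring
    · refine Finset.sum_congr rfl fun i _ => ?_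
      ring
  have := discrim_le_zero h
  rw [discrim] at this
  nlinarith

end IntegralForm

/-! ### Weak sequential compactness in Hilbert space. -/

section WeakCompactness

open Filter Topology

/-- Bounded sequences in a Hilbert space have weakly convergent subsequences. -/
theorem exists_weak_tendsto_subseq {H : Type*} [NormedAddCommGroup H] [InnerProductSpace ℝ H]
    [CompleteSpace H] (u : ℕ → H) {r : ℝ} (hu : ∀ n, ‖u n‖ ≤ r) :
    ∃ a : H, ‖a‖ ≤ r ∧ ∃ σ : ℕ → ℕ, StrictMono σ ∧
      ∀ y : H, Tendsto (fun n => inner ℝ (u (σ n)) y) atTop (𝓝 (inner ℝ a y)) := by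
  -- The closed span of the sequence is separable even if `H` is not, so the dual ball is weak-*
  -- sequentially compact. A test vector `y` acts on it through its projection.
  set S : Submodule ℝ H := (Submodule.span ℝ (Set.range u)).topologicalClosure with hS
  have hSclosed : IsClosed (S : Set H) := Submodule.isClosed_topologicalClosure _
  have hsep : TopologicalSpace.IsSeparable (S : Set H) := by
    rw [hS, Submodule.topologicalClosure_coe]
    exact ((Set.countable_range u).isSeparable.span).closure
  have : TopologicalSpace.SeparableSpace S := hsep.separableSpace
  have : CompleteSpace S := hSclosed.completeSpace_coe
  have hmem : ∀ n, u n ∈ S := fun n =>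
    Submodule.le_topologicalClosure _ (Submodule.subset_span ⟨n, rfl⟩)
  let v : ℕ → S := fun n => ⟨u n, hmem n⟩
  let w : ℕ → WeakDual ℝ S := fun n =>
    StrongDual.toWeakDual (InnerProductSpace.toDual ℝ S (v n))
  have hw : ∀ n, w n ∈ WeakDual.toStrongDual ⁻¹'
      Metric.closedBall (0 : StrongDual ℝ S) r := by
    intro n
    change InnerProductSpace.toDual ℝ S (v n) ∈ Metric.closedBall (0 : StrongDual ℝ S) r
    rw [mem_closedBall_zero_iff, LinearIsometryEquiv.norm_map]
    exact hu n
  obtain ⟨L, hL, σ, hσ, hlim⟩ := WeakDual.isSeqCompact_closedBall ℝ S 0 r hw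
  let a : S := (InnerProductSpace.toDual ℝ S).symm (WeakDual.toStrongDual L)
  refine ⟨a, ?_, σ, hσ, fun y => ?_⟩
  · have : ‖a‖ ≤ r := by
      rw [LinearIsometryEquiv.norm_map]
      exact mem_closedBall_zero_iff.1 hL
    exact this
  · have h := (WeakDual.eval_continuous (S.orthogonalProjectionOnto y)).continuousAt.tendsto.comp hlim
    have e : ∀ b : S, inner ℝ (b : H) y = inner ℝ b (S.orthogonalProjectionOnto y) := fun b => by
      rw [Submodule.inner_orthogonalProjectionOnto_eq_of_mem_left]
    have ha : inner ℝ (a : H) y = L (S.orthogonalProjectionOnto y) := by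
      rw [e, InnerProductSpace.toDual_symm_apply]
      rfl
    rw [ha]
    refine h.congr fun n => ?_
    exact (e (v (σ n))).symm

end WeakCompactness

/-! ### Compactness and the largest eigenvalue. -/

section Operator

open Filter Topology

theorem integralOperator_congr_ae {X : Type*} [MeasurableSpace X] {μ : Measure X}
    {k : X → X → ℝ} {φ ψ : X → ℝ} (h : φ =ᵐ[μ] ψ) :
    integralOperator k μ φ = integralOperator k μ ψ := by
  funext x
  refine integral_congr_ae ?_
  filter_upwards [h] with y hy
  rw [hy]

variable {X : Type*} [MeasurableSpace X] {μ : Measure X} [IsProbabilityMeasure μ]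
  {k : X → X → ℝ}

/-- Point evaluation of `K φ` is thus a continuous functional of `φ`, which turns weak convergence
into pointwise convergence. -/
theorem integralOperator_eq_inner (hk : IsKernel k)
    (hk_meas : Measurable (Function.uncurry k)) (hk_diag : ∀ x, k x x = 1) (φ : Lp ℝ 2 μ)
    (x : X) : integralOperator k μ φ x =
      inner ℝ φ ((memLp_kernel_section (μ := μ) hk hk_meas hk_diag x).toLp (k x)) := by
  rw [L2.inner_def]
  refine integral_congr_ae ?_
  filter_upwards [(memLp_kernel_section (μ := μ) hk hk_meas hk_diag x).coeFn_toLp] with y hy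
  simp [hy]

theorem norm_kernel_section_le (hk : IsKernel k)
    (hk_meas : Measurable (Function.uncurry k)) (hk_diag : ∀ x, k x x = 1) (x : X) :
    ‖(memLp_kernel_section (μ := μ) hk hk_meas hk_diag x).toLp (k x)‖ ≤ 1 := by
  refine (Lp.norm_le_of_ae_bound (C := 1) zero_le_one ?_).trans (by simp [measureUnivNNReal])
  filter_upwards [(memLp_kernel_section (μ := μ) hk hk_meas hk_diag x).coeFn_toLp] with y hy
  rw [hy]
  exact hk.abs_le_one hk_diag x y

theorem abs_integralOperator_le (hk : IsKernel k)
    (hk_meas : Measurable (Function.uncurry k)) (hk_diag : ∀ x, k x x = 1) (φ : Lp ℝ 2 μ)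
    (x : X) : |integralOperator k μ φ x| ≤ ‖φ‖ := by
  rw [integralOperator_eq_inner hk hk_meas hk_diag]
  refine (abs_real_inner_le_norm _ _).trans ?_
  exact mul_le_of_le_one_right (norm_nonneg _) (norm_kernel_section_le hk hk_meas hk_diag x)

theorem memLp_integralOperator (hk : IsKernel k)
    (hk_meas : Measurable (Function.uncurry k)) (hk_diag : ∀ x, k x x = 1) (φ : Lp ℝ 2 μ) :
    MemLp (integralOperator k μ φ) 2 μ := by
  refine MemLp.of_bound ?_ ‖φ‖
    (Eventually.of_forall fun x => abs_integralOperator_le hk hk_meas hk_diag φ x)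
  have h : StronglyMeasurable (fun p : X × X => k p.1 p.2 * φ p.2) :=
    hk_meas.stronglyMeasurable.mul
      ((Lp.stronglyMeasurable φ).comp_measurable measurable_snd)
  exact h.integral_prod_right'.aestronglyMeasurable

/-- The integral operator of `k` as a continuous linear map on `L²(μ)`. -/
noncomputable def integralOperatorL2 (hk : IsKernel k)
    (hk_meas : Measurable (Function.uncurry k)) (hk_diag : ∀ x, k x x = 1) :
    Lp ℝ 2 μ →L[ℝ] Lp ℝ 2 μ :=
  LinearMap.mkContinuous
    { toFun := fun φ => (memLp_integralOperator hk hk_meas hk_diag φ).toLp _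
      map_add' := fun φ ψ => by
        rw [← MemLp.toLp_add]
        congr 1
        funext x
        simp only [Pi.add_apply, integralOperator_eq_inner hk hk_meas hk_diag, inner_add_left]
      map_smul' := fun c φ => by
        rw [RingHom.id_apply, ← MemLp.toLp_const_smul]
        congr 1
        funext x
        simp only [Pi.smul_apply, integralOperator_eq_inner hk hk_meas hk_diag,
          real_inner_smul_left, smul_eq_mul] } 1 fun φ => by
    refine (Lp.norm_le_of_ae_bound (C := ‖φ‖) (norm_nonneg _) ?_).trans (by simp [measureUnivNNReal])
    simp only [LinearMap.coe_mk, AddHom.coe_mk]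
    filter_upwards [(memLp_integralOperator hk hk_meas hk_diag φ).coeFn_toLp] with x hx
    rw [hx]
    exact abs_integralOperator_le hk hk_meas hk_diag φ x

theorem coeFn_integralOperatorL2 (hk : IsKernel k)
    (hk_meas : Measurable (Function.uncurry k)) (hk_diag : ∀ x, k x x = 1) (φ : Lp ℝ 2 μ) :
    integralOperatorL2 hk hk_meas hk_diag φ =ᵐ[μ] integralOperator k μ φ :=
  (memLp_integralOperator hk hk_meas hk_diag φ).coeFn_toLp

theorem inner_integralOperatorL2 (hk : IsKernel k)
    (hk_meas : Measurable (Function.uncurry k)) (hk_diag : ∀ x, k x x = 1) (φ ψ : Lp ℝ 2 μ) :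
    inner ℝ (integralOperatorL2 hk hk_meas hk_diag φ) ψ =
      ∫ x, ψ x * integralOperator k μ φ x ∂μ := by
  rw [L2.inner_def]
  refine integral_congr_ae ?_
  filter_upwards [coeFn_integralOperatorL2 hk hk_meas hk_diag φ] with x hx
  simp [hx]

theorem isSymmetric_integralOperatorL2 (hk : IsKernel k)
    (hk_meas : Measurable (Function.uncurry k)) (hk_diag : ∀ x, k x x = 1) :
    (integralOperatorL2 (μ := μ) hk hk_meas hk_diag).IsSymmetric := fun φ ψ => by
  simp only [ContinuousLinearMap.coe_coe]
  rw [inner_integralOperatorL2, real_inner_comm, inner_integralOperatorL2]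
  exact integral_mul_integralOperator_comm hk hk_meas hk_diag (Lp.memLp φ) (Lp.memLp ψ)

/-- The images converge at every point and are uniformly bounded, so dominated convergence on a
probability space upgrades this to norm convergence. -/
theorem tendsto_integralOperatorL2_of_weak (hk : IsKernel k)
    (hk_meas : Measurable (Function.uncurry k)) (hk_diag : ∀ x, k x x = 1)
    {u : ℕ → Lp ℝ 2 μ} {a : Lp ℝ 2 μ} (hu : ∀ n, ‖u n‖ ≤ 1) (ha : ‖a‖ ≤ 1)
    (h : ∀ y : Lp ℝ 2 μ, Tendsto (fun n => inner ℝ (u n) y) atTop (𝓝 (inner ℝ a y))) :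
    Tendsto (fun n => integralOperatorL2 hk hk_meas hk_diag (u n)) atTop
      (𝓝 (integralOperatorL2 hk hk_meas hk_diag a)) := by
  set T := integralOperatorL2 (μ := μ) hk hk_meas hk_diag
  have hv : ∀ n, ‖u n - a‖ ≤ 2 := fun n =>
    (norm_sub_le _ _).trans (by linarith [hu n])
  have hsq : ∀ n, ‖T (u n) - T a‖ ^ 2 =
      ∫ x, integralOperator k μ (u n - a : Lp ℝ 2 μ) x ^ 2 ∂μ := by
    intro n
    rw [← map_sub, ← real_inner_self_eq_norm_sq, inner_integralOperatorL2]
    refine integral_congr_ae ?_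
    filter_upwards [coeFn_integralOperatorL2 hk hk_meas hk_diag (u n - a)] with x hx
    rw [hx, sq]
  have hlim : Tendsto (fun n => ‖T (u n) - T a‖ ^ 2) atTop (𝓝 0) := by
    simp_rw [hsq]
    have hint : (0 : ℝ) = ∫ _ : X, (0 : ℝ) ∂μ := by simp
    rw [hint]
    -- The constant is `2²`, from `|K(uₙ - a)| ≤ ‖uₙ - a‖ ≤ 2`.
    refine tendsto_integral_of_dominated_convergence (fun _ => 4) (fun n => ?_)
      (integrable_const _) (fun n => Eventually.of_forall fun x => ?_)
      (Eventually.of_forall fun x => ?_)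
    · exact (memLp_integralOperator hk hk_meas hk_diag _).aestronglyMeasurable.pow 2
    · have h1 := (abs_integralOperator_le hk hk_meas hk_diag (u n - a) x).trans (hv n)
      rw [Real.norm_eq_abs, abs_pow]
      nlinarith [abs_nonneg (integralOperator k μ (u n - a : Lp ℝ 2 μ) x)]
    · simp_rw [integralOperator_eq_inner hk hk_meas hk_diag, inner_sub_left]
      have := ((h ((memLp_kernel_section (μ := μ) hk hk_meas hk_diag x).toLp (k x))).sub_const
        (inner ℝ a ((memLp_kernel_section (μ := μ) hk hk_meas hk_diag x).toLp (k x)))).pow 2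
      simpa using this
  rw [tendsto_iff_norm_sub_tendsto_zero]
  have := hlim.sqrt
  simpa using this

theorem isCompactOperator_integralOperatorL2 (hk : IsKernel k)
    (hk_meas : Measurable (Function.uncurry k)) (hk_diag : ∀ x, k x x = 1) :
    IsCompactOperator (integralOperatorL2 (μ := μ) hk hk_meas hk_diag) := by
  have hc : IsCompact (integralOperatorL2 (μ := μ) hk hk_meas hk_diag ''
      Metric.closedBall 0 1) := by
    refine IsSeqCompact.isCompact fun v hv => ?_
    choose u hu huv using hv
    have hu' : ∀ n, ‖u n‖ ≤ 1 := fun n => mem_closedBall_zero_iff.1 (hu n)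
    obtain ⟨a, ha, σ, hσ, hlim⟩ := exists_weak_tendsto_subseq u hu'
    refine ⟨_, ⟨a, mem_closedBall_zero_iff.2 ha, rfl⟩, σ, hσ, ?_⟩
    refine (tendsto_integralOperatorL2_of_weak hk hk_meas hk_diag (fun n => hu' (σ n)) ha
      hlim).congr fun n => huv (σ n)
  refine (isCompactOperator_iff_isCompact_closure_image_closedBall
    (integralOperatorL2 (μ := μ) hk hk_meas hk_diag).toLinearMap one_pos).2 ?_
  exact hc.closure

theorem inner_integralOperatorL2_self_nonneg (hk : IsKernel k)
    (hk_meas : Measurable (Function.uncurry k)) (hk_diag : ∀ x, k x x = 1) (φ : Lp ℝ 2 μ) :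
    0 ≤ inner ℝ (integralOperatorL2 hk hk_meas hk_diag φ) φ := by
  rw [inner_integralOperatorL2]
  exact kernelEnergy_nonneg hk hk_meas hk_diag (Lp.memLp φ)

/-- For a positive symmetric operator the norm is the supremum of the Rayleigh quotients. Were it in
the resolvent set, these would stay a fixed `ε` below it. Compactness makes a nonzero spectral value
an eigenvalue. -/
theorem hasEigenvalue_norm_of_isCompactOperator {H : Type*} [NormedAddCommGroup H]
    [InnerProductSpace ℝ H] [CompleteSpace H] [Nontrivial H] {T : H →L[ℝ] H}
    (hT : IsCompactOperator T) (hsymm : T.IsSymmetric) (hpos : ∀ φ, 0 ≤ inner ℝ (T φ) φ) :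
    Module.End.HasEigenvalue (T : Module.End ℝ H) ‖T‖ := by
  -- The spectral criterion needs a nonzero value; for `T = 0` any nonzero vector is an eigenvector.
  by_cases h0 : T = 0
  · obtain ⟨φ, hφ⟩ := exists_ne (0 : H)
    refine Module.End.hasEigenvalue_of_hasEigenvector (x := φ) ⟨?_, hφ⟩
    simp [h0]
  have hne : ‖T‖ ≠ 0 := norm_ne_zero_iff.2 h0
  rw [hT.hasEigenvalue_iff_mem_spectrum hne]
  by_contra hmem
  obtain ⟨ε, hε, hle⟩ := T.rayleighQuotient_le_of_norm_mem_resolventSet (𝕜 := ℝ)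
    (by simpa [spectrum] using hmem)
  have habs : ∀ φ, |T.rayleighQuotient φ| ≤ ‖T‖ - ε := fun φ => by
    rw [abs_of_nonneg]
    · exact hle φ
    · exact div_nonneg (hpos φ) (sq_nonneg _)
  have h1 : ‖T‖ ≤ ‖T‖ - ε := by
    conv_lhs => rw [ContinuousLinearMap.norm_eq_iSup_rayleighQuotient T hsymm]
    exact ciSup_le habs
  linarith

/-- The integral operator has a largest eigenvalue, and it dominates the quadratic form. -/
theorem exists_isGreatest_eigenvalue (hk : IsKernel k)
    (hk_meas : Measurable (Function.uncurry k)) (hk_diag : ∀ x, k x x = 1) :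
    ∃ γ : ℝ, 0 ≤ γ ∧ IsGreatest {γ : ℝ | IsIntegralOperatorEigenvalue k μ γ} γ ∧
      ∀ φ : X → ℝ, MemLp φ 2 μ → kernelEnergy k μ φ ≤ γ * ∫ x, φ x ^ 2 ∂μ := by
  set T := integralOperatorL2 (μ := μ) hk hk_meas hk_diag with hT
  have hquad : ∀ φ : X → ℝ, MemLp φ 2 μ → kernelEnergy k μ φ ≤ ‖T‖ * ∫ x, φ x ^ 2 ∂μ := by
    intro φ hφ
    have e1 : kernelEnergy k μ φ = inner ℝ (T (hφ.toLp φ)) (hφ.toLp φ) := by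
      rw [hT, inner_integralOperatorL2, kernelEnergy, integralOperator_congr_ae hφ.coeFn_toLp]
      refine integral_congr_ae ?_
      filter_upwards [hφ.coeFn_toLp] with x hx
      rw [hx]
    have e2 : ∫ x, φ x ^ 2 ∂μ = ‖hφ.toLp φ‖ ^ 2 := by
      rw [← real_inner_self_eq_norm_sq, L2.inner_def]
      refine integral_congr_ae ?_
      filter_upwards [hφ.coeFn_toLp] with x hx
      simp [hx, sq]
    rw [e1, e2, sq, ← mul_assoc]
    exact (real_inner_le_norm _ _).trans
      (mul_le_mul_of_nonneg_right (T.le_opNorm _) (norm_nonneg _))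
  refine ⟨‖T‖, norm_nonneg _, ⟨?_, ?_⟩, hquad⟩
  · have : Nontrivial (Lp ℝ 2 μ) := by
      refine ⟨⟨Lp.const 2 μ 1, 0, fun h => ?_⟩⟩
      have := congrArg norm h
      rw [Lp.norm_const' _ _ _ two_ne_zero ENNReal.ofNat_ne_top] at this
      simp at this
    obtain ⟨φ, hφ⟩ := (hasEigenvalue_norm_of_isCompactOperator
      (isCompactOperator_integralOperatorL2 (μ := μ) hk hk_meas hk_diag)
      (isSymmetric_integralOperatorL2 hk hk_meas hk_diag)
      (inner_integralOperatorL2_self_nonneg hk hk_meas hk_diag)).exists_hasEigenvector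
    refine ⟨φ, Lp.memLp φ, fun h => hφ.2 ((Lp.eq_zero_iff_ae_eq_zero).2 h), ?_⟩
    have h := hφ.apply_eq_smul
    filter_upwards [coeFn_integralOperatorL2 hk hk_meas hk_diag φ, Lp.coeFn_smul ‖T‖ φ]
      with x hx hx'
    rw [← hx]
    change (T φ) x = _
    rw [show T φ = ‖T‖ • φ from h, hx']
    simp
  · rintro γ ⟨φ, hφ, hne, heig⟩
    have e : kernelEnergy k μ φ = γ * ∫ x, φ x ^ 2 ∂μ := by
      rw [kernelEnergy, ← integral_const_mul]
      refine integral_congr_ae ?_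
      filter_upwards [heig] with x hx
      rw [hx]
      ring
    have hpos : 0 < ∫ x, φ x ^ 2 ∂μ := by
      refine lt_of_le_of_ne (integral_nonneg fun x => sq_nonneg _) fun h => hne ?_
      have := (integral_eq_zero_iff_of_nonneg (fun x => sq_nonneg (φ x)) hφ.integrable_sq).1 h.symm
      filter_upwards [this] with x hx
      simpa using hx
    have := hquad φ hφ
    rw [e] at this
    exact le_of_mul_le_mul_right this hpos

end Operator

/-! ### Norms of kernel combinations. -/

section KernelCombination

variable {X : Type*} [MeasurableSpace X] {μ : Measure X} [IsProbabilityMeasure μ]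
  {k : X → X → ℝ}

theorem memLp_kernel_combination (hk : IsKernel k)
    (hk_meas : Measurable (Function.uncurry k)) (hk_diag : ∀ x, k x x = 1) {n : ℕ}
    (x : Fin n → X) (α : Fin n → ℝ) : MemLp (fun z => ∑ i, α i * k (x i) z) 2 μ :=
  memLp_finsetSum _ fun i _ => (memLp_kernel_section hk hk_meas hk_diag (x i)).const_mul (α i)

/-- Cauchy-Schwarz is tested with `φ = g`, the combination itself: the mixed term is then `N =
‖g‖²`, so `N² ≤ A · kernelEnergy k μ g ≤ A γ N`, and one factor `N` cancels. -/
theorem integral_sq_kernel_combination_le (hk : IsKernel k)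
    (hk_meas : Measurable (Function.uncurry k)) (hk_diag : ∀ x, k x x = 1) {γ : ℝ} (hγ : 0 ≤ γ)
    (hquad : ∀ φ : X → ℝ, MemLp φ 2 μ → kernelEnergy k μ φ ≤ γ * ∫ x, φ x ^ 2 ∂μ) {n : ℕ}
    (x : Fin n → X) (α : Fin n → ℝ) :
    ∫ z, (∑ i, α i * k (x i) z) ^ 2 ∂μ ≤ γ * ∑ i, ∑ j, α i * k (x i) (x j) * α j := by
  set g : X → ℝ := fun z => ∑ i, α i * k (x i) z with hg_def
  have hg : MemLp g 2 μ := memLp_kernel_combination hk hk_meas hk_diag x α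
  set N := ∫ z, g z ^ 2 ∂μ with hN
  set A := ∑ i, ∑ j, α i * k (x i) (x j) * α j
  have hA : 0 ≤ A := hk.quadForm_nonneg x α
  have hN0 : 0 ≤ N := integral_nonneg fun z => sq_nonneg _
  have e : ∑ i, α i * integralOperator k μ g (x i) = N := by
    simp only [integralOperator, ← integral_const_mul]
    rw [← integral_finsetSum _ fun i _ =>
      (integrable_kernel_mul hk hk_meas hk_diag (x i) hg).const_mul (α i)]
    refine integral_congr_ae (Filter.Eventually.of_forall fun z => ?_)
    simp only [sq, ← mul_assoc, ← Finset.sum_mul]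
    rfl
  have h := sq_sum_integralOperator_le hk hk_meas hk_diag x α hg
  rw [e] at h
  have h2 : N * N ≤ γ * A * N := by
    nlinarith [mul_le_mul_of_nonneg_left (hquad g hg) hA]
  rcases hN0.eq_or_lt with h0 | h0
  · rw [← h0]
    positivity
  · exact le_of_mul_le_mul_right h2 h0

theorem integral_sq_kernel_section_le (hk : IsKernel k)
    (hk_meas : Measurable (Function.uncurry k)) (hk_diag : ∀ x, k x x = 1) {γ : ℝ} (hγ : 0 ≤ γ)
    (hquad : ∀ φ : X → ℝ, MemLp φ 2 μ → kernelEnergy k μ φ ≤ γ * ∫ x, φ x ^ 2 ∂μ) (x : X) :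
    ∫ y, k x y ^ 2 ∂μ ≤ γ := by
  simpa [hk_diag] using integral_sq_kernel_combination_le hk hk_meas hk_diag hγ hquad
    (fun _ : Fin 1 => x) 1

theorem integrable_sq_kernel (hk : IsKernel k)
    (hk_meas : Measurable (Function.uncurry k)) (hk_diag : ∀ x, k x x = 1) :
    Integrable (fun p : X × X => k p.1 p.2 ^ 2) (μ.prod μ) := by
  refine Integrable.of_bound (hk_meas.pow_const 2).aestronglyMeasurable 1
    (Filter.Eventually.of_forall fun p => ?_)
  rw [Real.norm_eq_abs, abs_pow]
  exact pow_le_one₀ (abs_nonneg _) (hk.abs_le_one hk_diag p.1 p.2)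

theorem integral_sq_kernel_le (hk : IsKernel k)
    (hk_meas : Measurable (Function.uncurry k)) (hk_diag : ∀ x, k x x = 1) {γ : ℝ} (hγ : 0 ≤ γ)
    (hquad : ∀ φ : X → ℝ, MemLp φ 2 μ → kernelEnergy k μ φ ≤ γ * ∫ x, φ x ^ 2 ∂μ) :
    ∫ p : X × X, k p.1 p.2 ^ 2 ∂(μ.prod μ) ≤ γ := by
  have hint := integrable_sq_kernel (μ := μ) hk hk_meas hk_diag
  rw [integral_prod _ hint]
  calc ∫ x, ∫ y, k x y ^ 2 ∂μ ∂μ ≤ ∫ _ : X, γ ∂μ :=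
        integral_mono hint.integral_prod_left (integrable_const γ) fun x =>
          integral_sq_kernel_section_le hk hk_meas hk_diag hγ hquad x
    _ = γ := by simp

end KernelCombination

/-! ### Deterministic bounds for ridge regression. -/

section RidgeRegression

variable {X : Type*} {k : X → X → ℝ}

/-- The sum of the squared off-diagonal entries of the kernel matrix. -/
def offDiagonalSq (k : X → X → ℝ) {n : ℕ} (x : Fin n → X) : ℝ :=
  ∑ i, ∑ j, if i = j then 0 else k (x i) (x j) ^ 2

/-- The diagonal part is the identity, and the off-diagonal part has Frobenius norm at most `1/2`,
so it changes the form by at most half. -/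
theorem half_sum_sq_le_quadForm (hk_diag : ∀ x, k x x = 1) {n : ℕ} {x : Fin n → X}
    (hS : offDiagonalSq k x ≤ 1 / 4) (v : Fin n → ℝ) :
    1 / 2 * ∑ i, v i ^ 2 ≤ ∑ i, ∑ j, v i * k (x i) (x j) * v j := by
  set N := ∑ i, v i ^ 2 with hN
  have hN0 : 0 ≤ N := Finset.sum_nonneg fun i _ => sq_nonneg _
  set D : ℝ := ∑ i, ∑ j, v i * v j * if i = j then 0 else k (x i) (x j) with hD
  have e : ∑ i, ∑ j, v i * k (x i) (x j) * v j = N + D := by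
    rw [hN, hD, ← Finset.sum_add_distrib]
    refine Finset.sum_congr rfl fun i _ => ?_
    have : v i ^ 2 = ∑ j, if i = j then v i * v j else 0 := by simp [sq]
    rw [this, ← Finset.sum_add_distrib]
    refine Finset.sum_congr rfl fun j _ => ?_
    split_ifs with h
    · subst h
      rw [hk_diag]
      ring
    · ring
  have hCS : D ^ 2 ≤ N ^ 2 * offDiagonalSq k x := by
    have h := Finset.sum_mul_sq_le_sq_mul_sq (Finset.univ : Finset (Fin n × Fin n))
      (fun p => v p.1 * v p.2) (fun p => if p.1 = p.2 then 0 else k (x p.1) (x p.2))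
    simp only [Fintype.sum_prod_type] at h
    refine h.trans_eq ?_
    congr 1
    · rw [hN, sq, Finset.sum_mul_sum]
      simp only [mul_pow]
    · simp only [offDiagonalSq, ite_pow]
      simp
  have : D ^ 2 ≤ (N / 2) ^ 2 := by nlinarith [mul_le_mul_of_nonneg_left hS (sq_nonneg N)]
  have := (abs_le_of_sq_le_sq' this (by positivity)).1
  rw [e]
  linarith

theorem sum_mul_regularizedKernelMatrix_mulVec (lam : ℝ) {n : ℕ} (x : Fin n → X)
    (v : Fin n → ℝ) : ∑ i, v i * (regularizedKernelMatrix k lam x).mulVec v i =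
      (∑ i, ∑ j, v i * k (x i) (x j) * v j) + lam * ∑ i, v i ^ 2 := by
  rw [Finset.mul_sum, ← Finset.sum_add_distrib]
  refine Finset.sum_congr rfl fun i _ => ?_
  rw [regularizedKernelMatrix, Matrix.add_mulVec, Matrix.smul_mulVec, Matrix.one_mulVec]
  simp only [kernelMatrix, Pi.add_apply, Pi.smul_apply, smul_eq_mul, Matrix.mulVec, dotProduct,
    Matrix.of_apply, mul_add, Finset.mul_sum, mul_assoc]
  ring

theorem isUnit_regularizedKernelMatrix (hk_diag : ∀ x, k x x = 1) {n : ℕ} {x : Fin n → X}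
    (hS : offDiagonalSq k x ≤ 1 / 4) {lam : ℝ} (hlam : 0 ≤ lam) :
    IsUnit (regularizedKernelMatrix k lam x) := by
  rw [← Matrix.mulVec_injective_iff_isUnit]
  refine (injective_iff_map_eq_zero (Matrix.mulVecLin (regularizedKernelMatrix k lam x))).2
    fun v hv => ?_
  rw [Matrix.mulVecLin_apply] at hv
  have h := sum_mul_regularizedKernelMatrix_mulVec (k := k) lam x v
  rw [hv] at h
  simp only [Pi.zero_apply, mul_zero, Finset.sum_const_zero] at h
  have h1 := half_sum_sq_le_quadForm hk_diag hS v
  have hN0 : 0 ≤ ∑ i, v i ^ 2 := Finset.sum_nonneg fun i _ => sq_nonneg _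
  have hz : ∑ i, v i ^ 2 = 0 := by nlinarith [mul_nonneg hlam hN0]
  funext i
  exact pow_eq_zero_iff two_ne_zero |>.1
    ((Finset.sum_eq_zero_iff_of_nonneg fun i _ => sq_nonneg (v i)).1 hz i (Finset.mem_univ i))

/-- Pairing `(K + λ)α = y` with `α` gives `αᵀKα + λ|α|² = α · y`. The `λ` term is nonnegative and is
dropped, so the bound is uniform in `λ`. -/
theorem quadForm_ridgeCoeff_le (hk_diag : ∀ x, k x x = 1) {n : ℕ} {x : Fin n → X}
    (hS : offDiagonalSq k x ≤ 1 / 4) {lam : ℝ} (hlam : 0 ≤ lam) (y : Fin n → ℝ) :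
    ∑ i, ∑ j, ridgeCoeff k lam x y i * k (x i) (x j) * ridgeCoeff k lam x y j ≤
      2 * ∑ i, y i ^ 2 := by
  set α := ridgeCoeff k lam x y with hα
  have hu := isUnit_regularizedKernelMatrix hk_diag hS hlam
  have hy : (regularizedKernelMatrix k lam x).mulVec α = y := by
    rw [hα, ridgeCoeff, Matrix.mulVec_mulVec,
      Matrix.mul_nonsing_inv _ ((Matrix.isUnit_iff_isUnit_det _).1 hu), Matrix.one_mulVec]
  have h := sum_mul_regularizedKernelMatrix_mulVec (k := k) lam x α
  rw [hy] at h
  have h1 := half_sum_sq_le_quadForm hk_diag hS α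
  have hN0 : 0 ≤ ∑ i, α i ^ 2 := Finset.sum_nonneg fun i _ => sq_nonneg _
  -- With weight `1/4`, `|α|²/4 ≤ αᵀKα/2` is absorbed on the left.
  have h2 : ∑ i, α i * y i ≤ ∑ i, (α i ^ 2 / 4 + y i ^ 2) :=
    Finset.sum_le_sum fun i _ => by nlinarith [sq_nonneg (α i / 2 - y i)]
  rw [Finset.sum_add_distrib, ← Finset.sum_div] at h2
  nlinarith [mul_nonneg hlam hN0]

theorem sq_lpNorm_two {X : Type*} [MeasurableSpace X] {μ : Measure X} {g : X → ℝ}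
    (hg : MemLp g 2 μ) : lpNorm g 2 μ ^ 2 = ∫ x, g x ^ 2 ∂μ := by
  rw [lpNorm_eq_integral_norm_rpow_toReal two_ne_zero ENNReal.ofNat_ne_top
    hg.aestronglyMeasurable]
  have h0 : 0 ≤ ∫ x, ‖g x‖ ^ (2 : ℝ) ∂μ := integral_nonneg fun x => by positivity
  rw [ENNReal.toReal_ofNat, ← one_div, ← Real.sqrt_eq_rpow, Real.sq_sqrt h0]
  simp

/-- If the kernel matrix is close to the identity and the data are not too large, then the ridge
estimator is small compared to `f`. -/
theorem lpNorm_sub_ridgeEstimator_ge [MeasurableSpace X] {μ : Measure X}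
    [IsProbabilityMeasure μ] (hk : IsKernel k) (hk_meas : Measurable (Function.uncurry k))
    (hk_diag : ∀ x, k x x = 1) {γ : ℝ} (hγ : 0 ≤ γ)
    (hquad : ∀ φ : X → ℝ, MemLp φ 2 μ → kernelEnergy k μ φ ≤ γ * ∫ x, φ x ^ 2 ∂μ) {n : ℕ}
    {x : Fin n → X} (hS : offDiagonalSq k x ≤ 1 / 4) {f : X → ℝ} (hf : MemLp f 2 μ)
    {c : ℝ} (hc : 0 ≤ c) (y : Fin n → ℝ) (hy : ∑ i, y i ^ 2 ≤ c * ∫ z, f z ^ 2 ∂μ)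
    {lam : ℝ} (hlam : 0 ≤ lam) :
    (1 - √(2 * γ * c)) * lpNorm f 2 μ ≤
      lpNorm (fun z => f z - ridgeEstimator k lam x y z) 2 μ := by
  have hg : MemLp (ridgeEstimator k lam x y) 2 μ :=
    memLp_kernel_combination hk hk_meas hk_diag x _
  have h1 : lpNorm (ridgeEstimator k lam x y) 2 μ ≤ √(2 * γ * c) * lpNorm f 2 μ := by
    refine (pow_le_pow_iff_left₀ lpNorm_nonneg
      (mul_nonneg (Real.sqrt_nonneg _) lpNorm_nonneg) two_ne_zero).1 ?_
    rw [mul_pow, Real.sq_sqrt (by positivity), sq_lpNorm_two hg, sq_lpNorm_two hf]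
    calc ∫ z, ridgeEstimator k lam x y z ^ 2 ∂μ ≤ γ * (2 * ∑ i, y i ^ 2) :=
          (integral_sq_kernel_combination_le hk hk_meas hk_diag hγ hquad x _).trans
            (mul_le_mul_of_nonneg_left (quadForm_ridgeCoeff_le hk_diag hS hlam y) hγ)
      _ ≤ γ * (2 * (c * ∫ z, f z ^ 2 ∂μ)) := by gcongr
      _ = _ := by ring
  have h2 := lpNorm_le_lpNorm_add_lpNorm_sub' (f := f) hg one_le_two
  have h3 : f - ridgeEstimator k lam x y = fun z => f z - ridgeEstimator k lam x y z := rfl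
  rw [h3] at h2
  linarith

end RidgeRegression

/-! ### Markov bounds for the two bad events. -/

section Probability

variable {X Ω : Type*} [MeasurableSpace X] [MeasurableSpace Ω] {μ : Measure X}
  {k : X → X → ℝ} {P : Measure Ω} [IsProbabilityMeasure P]

theorem measureReal_offDiagonalSq_gt_le [IsProbabilityMeasure μ] (hk : IsKernel k)
    (hk_meas : Measurable (Function.uncurry k)) (hk_diag : ∀ x, k x x = 1) {γ : ℝ} (hγ : 0 ≤ γ)
    (hquad : ∀ φ : X → ℝ, MemLp φ 2 μ → kernelEnergy k μ φ ≤ γ * ∫ x, φ x ^ 2 ∂μ) {n : ℕ}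
    {x : Fin n → Ω → X} (hx : ∀ i, Measurable (x i)) (hlaw : ∀ i, P.map (x i) = μ)
    (hind : iIndepFun x P) :
    P.real {ω | 1 / 4 < offDiagonalSq k fun i => x i ω} ≤ γ * (n : ℝ) ^ 4 := by
  have key : ∀ i j : Fin n,
      Integrable (fun ω => if i = j then 0 else k (x i ω) (x j ω) ^ 2) P ∧
      ∫ ω, (if i = j then 0 else k (x i ω) (x j ω) ^ 2) ∂P ≤ γ - if i = j then γ else 0 := by
    intro i j
    by_cases hij : i = j
    · simp [hij]
    · have hp := measurePreserving_pair hx hlaw hind hij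
      have hint := integrable_sq_kernel (μ := μ) hk hk_meas hk_diag
      simp only [hij, if_false, sub_zero]
      refine ⟨hp.integrable_comp_of_integrable hint, ?_⟩
      rw [integral_comp_measurePreserving hp hint.aestronglyMeasurable]
      exact integral_sq_kernel_le hk hk_meas hk_diag hγ hquad
  have hSint : Integrable (fun ω => offDiagonalSq k fun i => x i ω) P :=
    integrable_finsetSum _ fun i _ => integrable_finsetSum _ fun j _ => (key i j).1
  have hSval : ∫ ω, offDiagonalSq k (fun i => x i ω) ∂P ≤ n * (n * γ - γ) := by
    simp only [offDiagonalSq]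
    rw [integral_finsetSum _ fun i _ => integrable_finsetSum _ fun j _ => (key i j).1]
    calc _ ≤ ∑ _i : Fin n, (n * γ - γ) := Finset.sum_le_sum fun i _ => by
          rw [integral_finsetSum _ fun j _ => (key i j).1]
          exact (Finset.sum_le_sum fun j _ => (key i j).2).trans_eq (by simp)
      _ = _ := by simp [mul_sub]
  have hS0 : ∀ ω, 0 ≤ offDiagonalSq k fun i => x i ω := fun ω =>
    Finset.sum_nonneg fun i _ => Finset.sum_nonneg fun j _ => by positivity
  have hM := mul_meas_ge_le_integral_of_nonneg (Filter.Eventually.of_forall hS0) hSint (1 / 4)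
  have hmono : P.real {ω | 1 / 4 < offDiagonalSq k fun i => x i ω} ≤
      P.real {ω | 1 / 4 ≤ offDiagonalSq k fun i => x i ω} :=
    measureReal_mono (Set.ofPred_subset_ofPred.2 fun ω hω => le_of_lt hω)
  -- Markov at level `1/4` yields `4 n (n - 1) γ`; this elementary bound brings it to `γ n⁴`,
  -- including `n = 0`.
  have hn : 4 * ((n : ℝ) * (n - 1)) ≤ (n : ℝ) ^ 4 := by
    have h0 : (0 : ℝ) ≤ n := n.cast_nonneg
    have : 4 * ((n : ℝ) - 1) ≤ (n : ℝ) ^ 3 := by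
      nlinarith [mul_nonneg h0 (sq_nonneg ((n : ℝ) - 3 / 2)), sq_nonneg ((n : ℝ) - 7 / 6)]
    nlinarith
  nlinarith [mul_le_mul_of_nonneg_left hn hγ]

/-- The mean is `n ∫ f²`, so Markov even gives `ε / n` when the mean is positive. -/
theorem measureReal_sum_sq_gt_le {n : ℕ} {x : Fin n → Ω → X} (hx : ∀ i, Measurable (x i))
    (hlaw : ∀ i, P.map (x i) = μ) {f : X → ℝ} (hf : MemLp f 2 μ) {ε : ℝ} (hε : 0 < ε) :
    P.real {ω | (n : ℝ) ^ 2 / ε * ∫ z, f z ^ 2 ∂μ < ∑ i, f (x i ω) ^ 2} ≤ ε := by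
  have hp : ∀ i, MeasurePreserving (x i) P μ := fun i => ⟨hx i, hlaw i⟩
  set F := ∫ z, f z ^ 2 ∂μ with hF
  have hF0 : 0 ≤ F := integral_nonneg fun z => sq_nonneg _
  have hint : ∀ i, Integrable (fun ω => f (x i ω) ^ 2) P := fun i =>
    (hp i).integrable_comp_of_integrable hf.integrable_sq
  have hZint : Integrable (fun ω => ∑ i, f (x i ω) ^ 2) P := integrable_finsetSum _ fun i _ => hint i
  have hZ0 : ∀ ω, 0 ≤ ∑ i, f (x i ω) ^ 2 := fun ω => Finset.sum_nonneg fun i _ => sq_nonneg _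
  have hZval : ∫ ω, ∑ i, f (x i ω) ^ 2 ∂P = n * F := by
    rw [integral_finsetSum _ fun i _ => hint i]
    rw [Finset.sum_congr rfl fun i _ => integral_comp_measurePreserving (hp i)
      (f := fun z => f z ^ 2) hf.integrable_sq.aestronglyMeasurable]
    simp [hF]
  -- If `n = 0` or `f = 0` almost everywhere, the threshold is zero and Markov is vacuous; the sum
  -- then vanishes almost surely.
  rcases (by positivity : 0 ≤ n * F).eq_or_lt with h0 | h0
  · rw [← h0] at hZval
    have hae := (integral_eq_zero_iff_of_nonneg hZ0 hZint).1 hZval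
    have : P.real {ω | (n : ℝ) ^ 2 / ε * F < ∑ i, f (x i ω) ^ 2} = 0 := by
      rw [measureReal_def, measure_eq_zero_iff_ae_notMem.2, ENNReal.toReal_zero]
      filter_upwards [hae] with ω hω hlt
      simp only [Pi.zero_apply] at hω
      have h : (n : ℝ) ^ 2 / ε * F < 0 := hω ▸ hlt
      have : 0 ≤ (n : ℝ) ^ 2 / ε * F := by positivity
      linarith
    rw [this]
    exact hε.le
  · have hM := mul_meas_ge_le_integral_of_nonneg (Filter.Eventually.of_forall hZ0) hZint
      ((n : ℝ) ^ 2 / ε * F)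
    rw [hZval] at hM
    have hmono : P.real {ω | (n : ℝ) ^ 2 / ε * F < ∑ i, f (x i ω) ^ 2} ≤
        P.real {ω | (n : ℝ) ^ 2 / ε * F ≤ ∑ i, f (x i ω) ^ 2} :=
      measureReal_mono (Set.ofPred_subset_ofPred.2 fun ω hω => le_of_lt hω)
    set p := P.real {ω | (n : ℝ) ^ 2 / ε * F ≤ ∑ i, f (x i ω) ^ 2}
    have hn : (1 : ℝ) ≤ n := by
      have : n ≠ 0 := by
        rintro rfl
        simp at h0
      exact_mod_cast Nat.one_le_iff_ne_zero.2 this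
    have h1 : n * F * (n * p / ε) ≤ n * F * 1 := by
      calc n * F * (n * p / ε) = (n : ℝ) ^ 2 / ε * F * p := by ring
        _ ≤ n * F * 1 := by linarith
    have h2 := (div_le_one hε).1 (le_of_mul_le_mul_left h1 h0)
    have hp0 : 0 ≤ p := measureReal_nonneg
    nlinarith

end Probability

theorem theorem3 {X : Type*} [MeasurableSpace X] (μ : Measure X) [IsProbabilityMeasure μ]
    (k : X → X → ℝ) (hk : IsKernel k) (hk_meas : Measurable (Function.uncurry k))
    (hk_diag : ∀ x, k x x = 1) :
    ∃ γmax : ℝ, IsGreatest {γ : ℝ | IsIntegralOperatorEigenvalue k μ γ} γmax ∧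
      ∀ {Ω : Type*} [MeasurableSpace Ω] (P : Measure Ω) [IsProbabilityMeasure P]
        (n : ℕ) (x : Fin n → Ω → X),
        (∀ i, Measurable (x i)) → (∀ i, P.map (x i) = μ) → iIndepFun x P →
        ∀ f : X → ℝ, MemLp f 2 μ → ∀ ε : ℝ, 0 < ε →
          ∃ E : Set Ω, MeasurableSet E ∧ 1 - ε - γmax * (n : ℝ) ^ 4 ≤ P.real E ∧
            ∀ ω ∈ E, ∀ lam : ℝ, 0 ≤ lam →
              IsUnit (regularizedKernelMatrix k lam fun i => x i ω) ∧
              (1 - √(2 * γmax * (n : ℝ) ^ 2 / ε)) * lpNorm f 2 μ ≤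
                lpNorm (fun z => f z -
                  ridgeEstimator k lam (fun i => x i ω) (fun i => f (x i ω)) z) 2 μ := by
  obtain ⟨γ, hγ, hgreatest, hquad⟩ := exists_isGreatest_eigenvalue (μ := μ) hk hk_meas hk_diag
  refine ⟨γ, hgreatest, ?_⟩
  intro Ω _ P _ n x hx hlaw hind f hf ε hε
  set bad := {ω | 1 / 4 < offDiagonalSq k fun i => x i ω} ∪
    {ω | (n : ℝ) ^ 2 / ε * ∫ z, f z ^ 2 ∂μ < ∑ i, f (x i ω) ^ 2}
  -- As `f` is only almost everywhere measurable, `bad` need not be measurable; its measurable hull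
  -- has the same measure. Neither bad event involves `lam`.
  refine ⟨(toMeasurable P bad)ᶜ, (measurableSet_toMeasurable P bad).compl, ?_, ?_⟩
  · have hbad : P.real bad ≤ γ * (n : ℝ) ^ 4 + ε := (measureReal_union_le _ _).trans
      (add_le_add (measureReal_offDiagonalSq_gt_le hk hk_meas hk_diag hγ hquad hx hlaw hind)
        (measureReal_sum_sq_gt_le hx hlaw hf hε))
    have e : P.real (toMeasurable P bad) = P.real bad := by
      rw [measureReal_def, measure_toMeasurable, measureReal_def]
    rw [probReal_compl_eq_one_sub (measurableSet_toMeasurable P bad), e]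
    linarith
  · intro ω hω lam hlam
    have hgood : ω ∉ bad := fun h => hω (subset_toMeasurable P bad h)
    simp only [bad, Set.mem_union, Set.mem_ofPred_eq, not_or, not_lt] at hgood
    refine ⟨isUnit_regularizedKernelMatrix hk_diag hgood.1 hlam, ?_⟩
    rw [mul_div_assoc]
    exact lpNorm_sub_ridgeEstimator_ge hk hk_meas hk_diag hγ hquad hgood.1 hf (by positivity) _
      hgood.2 hlam
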